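/- We use the following notions. A represented space $\mathbf{X}$ is a set $X$ with a partial surjection $\delta_{\mathbf{X}} :\subseteq \{0,1\}^{\mathbb{N}} \to X$; any $p$ with $\delta_{\mathbf{X}}(p) = x$ is called a name of $x$. A map between represented spaces is continuous if some continuous partial function on $\{0,1\}^{\mathbb{N}}$ sends every name of each point to a name of its image. $\mathcal{C}(\mathbf{X},\mathbf{Y})$ is the represented space of continuous maps from $\mathbf{X}$ to $\mathbf{Y}$, where a name of $f$ encodes a (possibly oracle-dependent) Type-2 machine transforming names of each $x$ into names of $f(x)$. $\mathbb{N}$ is represented by $\delta_{\mathbb{N}}(0^n10^{\mathbb{N}}) = n$, and the Sierpiński space $\mathbb{S} = \{\bot,\top\}$ by $\delta_{\mathbb{S}}(0^{\mathbb{N}}) = \bot$ and $\delta_{\mathbb{S}}(p) = \top$ for $p \neq 0^{\mathbb{N}}$. $\mathbf{X}'$ is the set $X$ with the representation $\delta_{\mathbf{X}} \circ \lim$, where $\lim(p)(n) = \lim_{i\to\infty} p(\langle n,i\rangle)$. Put $\mathcal{O}(\mathbf{X}) = \mathcal{C}(\mathbf{X},\mathbb{S})$ (open sets) and $\mathcal{O}'(\mathbf{X})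 = \mathcal{C}(\mathbf{X},\mathbb{S}')$ ($'$-open sets), where a map into $\{\bot,\top\}$ is identified with the preimage of $\top$. Let $\mathbf{X}$ be a computable metric space, that is, a metric space with a dense sequence $(a_i)_{i\in\mathbb{N}}$ for which $(i,j) \mapsto d(a_i,a_j)$ is computable, represented by its Cauchy representation: a name of $x$ encodes a sequence $(c_n)_n$ of indices with $d(a_{c_n},x) \leq 2^{-n}$ for all $n$. Then the map $$\mathcal{C}(\mathbb{N},\mathcal{O}(\mathbf{X})) \to \mathcal{O}'(\mathbf{X}), \qquad (U_n)_{n\in\mathbb{N}} \mapsto \bigcup_{n\in\mathbb{N}} (X \setminus U_n),$$ admits a total computable multivalued inverse: there is a Type-2 machine that transforms every name of every $A \in \mathcal{O}'(\mathbf{X})$ into a name of some sequence $(U_n)_{n\in\mathbb{N}} \in \mathcal{C}(\mathbb{N},\mathcal{O}(\mathbf{X}))$ with $A = \bigcup_{n\in\mathbb{N}} (X \setminus U_n)$. -/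

import Mathlib

open Set Filter Topology

universe u v

/-- Cantor space `{0,1}^ℕ`, with the product topology. -/
abbrev Cantor : Type := ℕ → Bool

/-- The initial segment `p(0) p(1) … p(s-1)` of `p`. -/
def initSeg (p : Cantor) (s : ℕ) : List Bool := (List.range s).map p

/-- `Computes h p r`: the Type-2 machine with table `h` produces the output `r` on the input `p`.
The value `h w n` is what the machine has decided about the output bit number `n` after reading the
initial segment `w` of its input: `none` if it has not decided yet (it reads on), `some b` if it
writes `b`. So the output bit is the first value that appears, and it has to appear for every
`n`. The output `r` is uniquely determined by `h` and `p`. -/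
def Computes (h : List Bool → ℕ → Option Bool) (p r : Cantor) : Prop :=
  ∀ n, ∃ s, h (initSeg p s) n = some (r n) ∧ ∀ t < s, h (initSeg p t) n = none

/-- A represented space: a set together with a partial surjection `δ` from Cantor space onto it;
`Names p x` says that `p` is in the domain of `δ` and `δ p = x`. -/
structure RepresentedSpace where
  carrier : Type u
  Names : Cantor → carrier → Prop
  unique : ∀ {p x y}, Names p x → Names p y → x = y
  exists_name : ∀ x, ∃ p, Names p x

namespace RepresentedSpace

/-- The domain of the representation. -/
def dom (X : RepresentedSpace.{u}) : Set Cantor := {p | ∃ x, X.Names p x}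

/-- `F` is a realizer of `f`. -/
def Realizes {X : RepresentedSpace.{u}} {Y : RepresentedSpace.{v}}
    (F : Cantor → Cantor) (f : X.carrier → Y.carrier) : Prop :=
  ∀ p x, X.Names p x → Y.Names (F p) (f x)

/-- A map between represented spaces is continuous if it has a continuous realizer. -/
def IsContinuousMap {X : RepresentedSpace.{u}} {Y : RepresentedSpace.{v}}
    (f : X.carrier → Y.carrier) : Prop :=
  ∃ F : Cantor → Cantor, ContinuousOn F X.dom ∧ Realizes (X := X) (Y := Y) F f

/-- A total multivalued map `G` from `X` to `Y` is computable if there is a Type-2 machine (with a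
computable table) that maps every name of every point `x` to a name of some element of `G x`. -/
def IsComputableMultivalued {X : RepresentedSpace.{u}} {Y : RepresentedSpace.{v}}
    (G : X.carrier → Set Y.carrier) : Prop :=
  ∃ h : List Bool → ℕ → Option Bool, Computable₂ h ∧
    ∀ p x, X.Names p x → ∃ r, Computes h p r ∧ ∃ y ∈ G x, Y.Names r y

/-- `f : X → Y` admits a computable multivalued inverse: from every name of every `y` in `Y` one can
compute a name of some `x` in `X` with `f x = y`. -/
def HasComputableMultivaluedInverse {X : RepresentedSpace.{u}} {Y : RepresentedSpace.{v}}
    (f : X.carrier → Y.carrier) : Prop :=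
  IsComputableMultivalued (X := Y) (Y := X) fun y => {x | f x = y}

/-- The natural numbers, where the only name of `n` is `0^n 1 0 0 0 …`. -/
def nat : RepresentedSpace.{0} where
  carrier := ℕ
  Names p n := p = fun k => decide (k = n)
  unique := by
    intro p x y hx hy
    have h := congrFun (hx.symm.trans hy) x
    simpa using h
  exists_name n := ⟨_, rfl⟩

/-- Sierpiński space, with `⊤` as `True` and `⊥` as `False`: the name `000…` denotes `⊥`,
all others denote `⊤`. -/
def sierpinski : RepresentedSpace.{0} where
  carrier := Prop
  Names p x := x ↔ ∃ n, p n = true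
  unique hx hy := propext (hx.trans hy.symm)
  exists_name x := by
    by_cases hx : x
    · exact ⟨fun _ => true, by simp [hx]⟩
    · exact ⟨fun _ => false, by simp [hx]⟩

/-- `IsLim p q`: `p` is in the domain of `lim` and `lim p = q`, where
`(lim p)(n) = lim_{i → ∞} p(⟨n, i⟩)`. -/
def IsLim (p q : Cantor) : Prop :=
  ∀ n, Tendsto (fun i => p (Nat.pair n i)) atTop (𝓝 (q n))

/-- The jump `X'` of a represented space: same points, representation `δ ∘ lim`. -/
def jump (X : RepresentedSpace.{u}) : RepresentedSpace.{u} where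
  carrier := X.carrier
  Names p x := ∃ q, IsLim p q ∧ X.Names q x
  unique := by
    rintro p x y ⟨q, hq, hx⟩ ⟨q', hq', hy⟩
    have : q = q' := funext fun n => tendsto_nhds_unique (hq n) (hq' n)
    subst this
    exact X.unique hx hy
  exists_name x := by
    obtain ⟨q, hq⟩ := X.exists_name x
    exact ⟨fun m => q (Nat.unpair m).1, q, fun n => by simp, hq⟩

/-- The machine table that is coded by a point `q` of Cantor space: for each `w` and `n`, one bit
of `q` says whether the entry at `(w, n)` is defined, and another one is its value. -/
def tableOf (q : Cantor) (w : List Bool) (n : ℕ) : Option Bool :=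
  if q (Encodable.encode (w, n, false)) = true then some (q (Encodable.encode (w, n, true)))
  else none

theorem initSeg_eq_iff {p p' : Cantor} {s : ℕ} :
    initSeg p s = initSeg p' s ↔ ∀ i < s, p i = p' i := by
  simp [initSeg]

/-- Every function that is continuous on a subset of Cantor space is given there by a table. -/
theorem exists_table {D : Set Cantor} {F : Cantor → Cantor} (hF : ContinuousOn F D) :
    ∃ q, ∀ p ∈ D, Computes (tableOf q) p (F p) := by
  classical
  let ok : List Bool → ℕ → Bool → Prop := fun w n b =>
    ∀ p ∈ D, initSeg p w.length = w → F p n = b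
  let q : Cantor := fun m =>
    match (Encodable.decode m : Option (List Bool × ℕ × Bool)) with
    | some (w, n, false) => decide (∃ b, ok w n b)
    | some (w, n, true) => decide (ok w n true)
    | none => false
  have hlen : ∀ (p : Cantor) (s : ℕ), (initSeg p s).length = s := by
    intro p s; simp [initSeg]
  refine ⟨q, fun p hp n => ?_⟩
  have hval : ∀ s, tableOf q (initSeg p s) n =
      if ∃ b, ok (initSeg p s) n b then some (F p n) else none := by
    intro s
    by_cases h : ∃ b, ok (initSeg p s) n b
    · obtain ⟨b, hb⟩ := h
      have hFb : F p n = b := hb p hp (by rw [hlen])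
      have : decide (ok (initSeg p s) n true) = b := by
        cases b
        · simp only [decide_eq_false_iff_not]
          intro h'
          have := h' p hp (by rw [hlen])
          rw [hFb] at this
          exact absurd this (by simp)
        · simpa using hb
      have hex : ∃ b, ok (initSeg p s) n b := ⟨b, hb⟩
      simp only [tableOf, q, Encodable.encodek, hex, this, hFb, decide_true, if_true]
    · simp only [tableOf, q, Encodable.encodek, h, decide_false, Bool.false_eq_true, if_false]
  have hex : ∃ s, ∃ b, ok (initSeg p s) n b := by
    have hc : ContinuousWithinAt (fun p => F p n) D p :=
      ((continuous_apply n).comp_continuousOn hF) p hp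
    have hev : ∀ᶠ p' in 𝓝[D] p, F p' n = F p n := by
      have : {F p n} ∈ 𝓝 (F p n) := by simp
      exact hc this
    rw [eventually_nhdsWithin_iff] at hev
    obtain ⟨V, ⟨x, s, rfl⟩, hpV, hV⟩ :=
      (PiNat.isTopologicalBasis_cylinders (fun _ : ℕ => Bool)).mem_nhds_iff.1 hev
    refine ⟨s, F p n, fun p' hp' heq => ?_⟩
    rw [hlen, initSeg_eq_iff] at heq
    refine hV ?_ hp'
    rw [PiNat.mem_cylinder_iff] at hpV ⊢
    intro i hi
    rw [heq i hi, hpV i hi]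
  refine ⟨Nat.find hex, ?_, fun t ht => ?_⟩
  · rw [hval, if_pos (Nat.find_spec hex)]
  · rw [hval, if_neg (Nat.find_min hex ht)]

/-- The represented space `C(X, Y)` of continuous maps: `q` is a name of `f` if the Type-2 machine
whose table is coded by `q` computes a realizer of `f`. -/
def contMaps (X : RepresentedSpace.{u}) (Y : RepresentedSpace.{v}) :
    RepresentedSpace.{max u v} where
  carrier := {f : X.carrier → Y.carrier // IsContinuousMap f}
  Names q f := ∀ p x, X.Names p x → ∃ r, Computes (tableOf q) p r ∧ Y.Names r (f.1 x)
  unique := by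
    intro q f g hf hg
    apply Subtype.ext
    funext x
    obtain ⟨p, hp⟩ := X.exists_name x
    obtain ⟨r, hr, hrf⟩ := hf p x hp
    obtain ⟨r', hr', hrg⟩ := hg p x hp
    have : r = r' := by
      funext n
      obtain ⟨s, hs, hs'⟩ := hr n
      obtain ⟨t, ht, ht'⟩ := hr' n
      rcases lt_trichotomy s t with h | h | h
      · rw [ht' s h] at hs; cases hs
      · subst h; rw [hs] at ht; exact Option.some.inj ht
      · rw [hs' t h] at ht; cases ht
    subst this
    exact Y.unique hrf hrg
  exists_name f := by
    obtain ⟨F, hF, hFf⟩ := f.2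
    obtain ⟨q, hq⟩ := exists_table hF
    exact ⟨q, fun p x hp => ⟨F p, hq p ⟨x, hp⟩, hFf p x hp⟩⟩

/-- The space `O(X) = C(X, S)` of open sets; `U.1 x` says that `x` belongs to `U`. -/
def opens (X : RepresentedSpace.{u}) : RepresentedSpace.{u} := contMaps X sierpinski

/-- The space `O'(X) = C(X, S')` of `'`-open sets; `U.1 x` says that `x` belongs to `U`. -/
def jumpOpens (X : RepresentedSpace.{u}) : RepresentedSpace.{u} := contMaps X (jump sierpinski)

theorem isContinuousMap_union_compl (X : RepresentedSpace.{u})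
    (U : (contMaps nat (opens X)).carrier) :
    IsContinuousMap (X := X) (Y := jump sierpinski) fun x => ∃ n : ℕ, ¬ (U.1 n).1 x := by
  classical
  choose F hF hFU using fun n : ℕ => (U.1 n).2
  let A : Cantor → ℕ → ℕ → Bool := fun p n i => decide (∀ m ∈ Finset.range (i + 1), F n p m = false)
  refine ⟨fun p k => A p (Nat.unpair k).1 (Nat.unpair k).2, ?_, fun p x hp => ?_⟩
  · refine continuousOn_pi.2 fun k p hp => ?_
    have hev : ∀ᶠ p' in 𝓝[X.dom] p, ∀ m ∈ Finset.range ((Nat.unpair k).2 + 1),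
        F (Nat.unpair k).1 p' m = F (Nat.unpair k).1 p m := by
      rw [Filter.eventually_all_finset]
      intro m _
      have hc : ContinuousWithinAt (fun p => F (Nat.unpair k).1 p m) X.dom p :=
        ((continuous_apply m).comp_continuousOn (hF (Nat.unpair k).1)) p hp
      exact hc (by simp : {F (Nat.unpair k).1 p m} ∈ 𝓝 _)
    refine tendsto_nhds_of_eventually_eq ?_
    filter_upwards [hev] with p' h
    simp only [A]
    congr 1
    exact propext (forall₂_congr fun m hm => by rw [h m hm])
  · refine ⟨fun n => decide (∀ m, F n p m = false), fun n => ?_, ?_⟩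
    · refine tendsto_nhds_of_eventually_eq ?_
      simp only [Nat.unpair_pair]
      by_cases h : ∀ m, F n p m = false
      · exact Eventually.of_forall fun i => by simp [A, h]
      · obtain ⟨m, hm⟩ := not_forall.1 h
        filter_upwards [eventually_ge_atTop m] with i hi
        have h' : ¬ ∀ m ∈ Finset.range (i + 1), F n p m = false := fun H =>
          hm (H m (Finset.mem_range.2 (by omega)))
        simp only [A, h, h', decide_false]
    · have key : ∀ n, (U.1 n).1 x ↔ ∃ m, F n p m = true := fun n => hFU n p x hp
      change (∃ n : ℕ, ¬ (U.1 n).1 x) ↔ _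
      refine exists_congr fun n => ?_
      rw [key n]
      simp

/-- The map `(U_n)_n ↦ ⋃_n (X \ U_n)` from `C(ℕ, O(X))` to `O'(X)`. -/
def unionCompl (X : RepresentedSpace.{u}) (U : (contMaps nat (opens X)).carrier) :
    (jumpOpens X).carrier :=
  ⟨fun x => ∃ n : ℕ, ¬ (U.1 n).1 x, isContinuousMap_union_compl X U⟩

end RepresentedSpace

/-- The structure of a computable metric space on a metric space `X`: a dense sequence whose mutual
distances form a computable double sequence of real numbers. Completeness is not required. -/
structure ComputableMetricStructure (X : Type u) [MetricSpace X] where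
  point : ℕ → X
  dense : DenseRange point
  dist_computable : ∃ f : ℕ × ℕ × ℕ → ℕ, Computable f ∧
    ∀ i j k, |dist (point i) (point j) - (f (i, j, k) : ℝ) / 2 ^ k| ≤ 1 / 2 ^ k

/-- A computable metric space as a represented space, with its Cauchy representation: a name of `x`
codes (by its graph) a sequence `c` of indices such that the points number `c 0, c 1, …` of the
dense sequence converge to `x` with the `n`-th one at distance at most `2^(-n)`. -/
def ComputableMetricStructure.space {X : Type u} [MetricSpace X]
    (M : ComputableMetricStructure X) : RepresentedSpace.{u} where
  carrier := X
  Names p x := ∃ c : ℕ → ℕ, (∀ n k, p (Nat.pair n k) = decide (c n = k)) ∧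
    ∀ n, dist (M.point (c n)) x ≤ 1 / 2 ^ n
  unique := by
    rintro p x y ⟨c, hc, hx⟩ ⟨c', hc', hy⟩
    have hcc : c = c' := by
      funext n
      have h := hc n (c' n)
      rw [hc' n (c' n)] at h
      simpa using h.symm
    subst hcc
    have lim : Tendsto (fun n : ℕ => (1 : ℝ) / 2 ^ n) atTop (𝓝 0) := by
      simpa using tendsto_pow_atTop_nhds_zero_of_lt_one (r := (1 / 2 : ℝ)) (by norm_num)
        (by norm_num)
    have tx : Tendsto (fun n => M.point (c n)) atTop (𝓝 x) :=
      tendsto_iff_dist_tendsto_zero.2 (squeeze_zero (fun _ => dist_nonneg) hx lim)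
    have ty : Tendsto (fun n => M.point (c n)) atTop (𝓝 y) :=
      tendsto_iff_dist_tendsto_zero.2 (squeeze_zero (fun _ => dist_nonneg) hy lim)
    exact tendsto_nhds_unique tx ty
  exists_name x := by
    have h : ∀ n : ℕ, ∃ k, dist (M.point k) x ≤ 1 / 2 ^ n := by
      intro n
      obtain ⟨k, hk⟩ := M.dense.exists_dist_lt x (by positivity : (0 : ℝ) < 1 / 2 ^ n)
      exact ⟨k, by rw [dist_comm]; exact hk.le⟩
    choose c hc using h
    exact ⟨fun m => decide (c (Nat.unpair m).1 = (Nat.unpair m).2), c, by simp, hc⟩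

/-! The proof is a Baire category argument in the space of names of one point, so completeness of
`X` plays no role. Fix a name `q` of `A` and a point `x`. The sequences `c` with `d(a_{c_j}, x) <
2⁻ʲ` for all `j` form a product of nonempty discrete sets, which is a Baire space, and each of them
gives a name of `x`. On such a name the machine `q` writes a limit name, and `x ∈ A` iff some column
`n` is constantly `true` from some place `i₀` on. For fixed `(n, i₀)` this is a closed condition on
`c`. If `x ∈ A`, these countably many closed sets cover the product, so one of them contains the
cylinder of a finite prefix `a`. Conversely, a single name in such a cylinder shows that `x ∈ A`.

Hence `x ∈ A` iff, for some `a, n, i₀`, the prefix `a` starts a strict name of `x` and no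
continuation of `a` that is still near `x` makes `q` write `false` in column `n` at or after `i₀`
(`iff_exists_not_pieceCompl`; the category step is `exists_generic_name`). The second condition is
closed in `x`; the first is open, and becomes a union of closed conditions through the margins
`2⁻ᵏ`. The complement of each piece `(a, n, i₀, k)` is semidecidable from `q` and a name of `x`:
search for a finite witness and verify it with rational approximations to distances
(`codedOpen_of_checkIndex`, `exists_checkIndex`). The pieces are numbered by their codes. -/

/-! ### Initial segments, graphs of sequences and tables -/

@[simp] theorem length_initSeg (p : Cantor) (s : ℕ) : (initSeg p s).length = s := by
  simp [initSeg]

theorem getElem?_initSeg (p : Cantor) (s i : ℕ) :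
    (initSeg p s)[i]? = if i < s then some (p i) else none := by
  by_cases h : i < s
  · simp [initSeg, h]
  · simp only [h, if_false]
    exact List.getElem?_eq_none (by simpa using h)

theorem getElem?_initSeg_of_lt (p : Cantor) {s i : ℕ} (h : i < s) :
    (initSeg p s)[i]? = some (p i) := by
  rw [getElem?_initSeg, if_pos h]

theorem eq_of_getElem?_initSeg {p : Cantor} {s i : ℕ} {b : Bool}
    (h : (initSeg p s)[i]? = some b) : p i = b := by
  rw [getElem?_initSeg] at h
  split_ifs at h
  simpa using h

/-- The graph of a sequence of natural numbers, as a point of Cantor space. -/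
def graphName (c : ℕ → ℕ) : Cantor := fun m => decide (c (Nat.unpair m).1 = (Nat.unpair m).2)

/-- Bit number `m` of a graph concerns the value of the sequence at the first component of `m`,
which is at most `m`. -/
theorem initSeg_graphName_congr {c c' : ℕ → ℕ} {s : ℕ} (h : ∀ i < s, c i = c' i) :
    initSeg (graphName c) s = initSeg (graphName c') s := by
  rw [RepresentedSpace.initSeg_eq_iff]
  intro i hi
  simp only [graphName]
  rw [h _ ((Nat.unpair_left_le i).trans_lt hi)]

namespace RepresentedSpace

/-- A map whose names are transformed by some table is continuous. -/
theorem isContinuousMap_of_table {X : RepresentedSpace.{u}} {Y : RepresentedSpace.{v}}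
    {f : X.carrier → Y.carrier} (h : List Bool → ℕ → Option Bool)
    (hf : ∀ p x, X.Names p x → ∃ r, Computes h p r ∧ Y.Names r (f x)) :
    IsContinuousMap (X := X) (Y := Y) f := by
  classical
  -- One output serves all `x`, because `p` names at most one point.
  have key : ∀ p, ∃ r, ∀ x, X.Names p x → Computes h p r ∧ Y.Names r (f x) := by
    intro p
    by_cases hp : ∃ x, X.Names p x
    · obtain ⟨x, hx⟩ := hp
      obtain ⟨r, hr⟩ := hf p x hx
      exact ⟨r, fun y hy => X.unique hx hy ▸ hr⟩
    · exact ⟨p, fun x hx => (hp ⟨x, hx⟩).elim⟩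
  choose F hF using key
  refine ⟨F, continuousOn_pi.2 fun n p hp => ?_, fun p x hx => (hF p x hx).2⟩
  obtain ⟨x, hx⟩ := hp
  obtain ⟨s, hs, hs'⟩ := (hF p x hx).1 n
  have hcyl : ∀ᶠ p' in 𝓝[X.dom] p, initSeg p' s = initSeg p s := by
    have : ∀ᶠ p' in 𝓝 p, ∀ i ∈ Finset.range s, p' i = p i := by
      rw [Filter.eventually_all_finset]
      intro i _
      have hc : ContinuousAt (fun p' : Cantor => p' i) p := (continuous_apply i).continuousAt
      exact hc (by simp : {p i} ∈ 𝓝 (p i))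
    filter_upwards [nhdsWithin_le_nhds this] with p' hp'
    exact initSeg_eq_iff.2 fun i hi => hp' i (Finset.mem_range.2 hi)
  refine tendsto_nhds_of_eventually_eq ?_
  filter_upwards [hcyl, self_mem_nhdsWithin] with p' hp' hdom
  obtain ⟨y, hy⟩ := hdom
  obtain ⟨t, ht, ht'⟩ := (hF p' y hy).1 n
  have hpre : ∀ k ≤ s, initSeg p' k = initSeg p k := fun k hk =>
    initSeg_eq_iff.2 fun i hi => initSeg_eq_iff.1 hp' i (hi.trans_le hk)
  rcases lt_trichotomy s t with hlt | heq | hgt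
  · have := ht' s hlt
    rw [hp', hs] at this
    cases this
  · subst heq
    rw [hp', hs] at ht
    exact (Option.some.inj ht).symm
  · have := hs' t hgt
    rw [← hpre t hgt.le, ht] at this
    cases this

theorem tableOf_eq_none {q : Cantor} {w : List Bool} {n : ℕ} :
    tableOf q w n = none ↔ q (Encodable.encode (w, n, false)) = false := by
  rw [tableOf]
  split_ifs with h
  · simp only [h, reduceCtorEq]
  · simp only [Bool.eq_false_of_not_eq_true h]

theorem tableOf_eq_some {q : Cantor} {w : List Bool} {n : ℕ} {b : Bool} :
    tableOf q w n = some b ↔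
      q (Encodable.encode (w, n, false)) = true ∧ q (Encodable.encode (w, n, true)) = b := by
  rw [tableOf]
  split_ifs with h <;> simp only [h, Option.some.injEq, true_and, reduceCtorEq, false_and]

end RepresentedSpace

/-! ### Finite prefixes that force an output bit -/

open RepresentedSpace

/-- The list `v`, continued by zeros. -/
def listSeq (v : List ℕ) (i : ℕ) : ℕ := v.getD i 0

theorem listSeq_append_left {v w : List ℕ} {i : ℕ} (h : i < v.length) :
    listSeq (v ++ w) i = listSeq v i := by
  simp [listSeq, List.getElem?_append_left h]

/-- Every Cauchy name that starts with the indices `v` makes the machine `q` write `false` as output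
bit number `m`, after reading only bits that are determined by `v`. -/
def Refutes (q : Cantor) (v : List ℕ) (m : ℕ) : Prop :=
  ∃ s ≤ v.length, tableOf q (initSeg (graphName (listSeq v)) s) m = some false ∧
    ∀ t < s, tableOf q (initSeg (graphName (listSeq v)) t) m = none

/-- The runs on `c` and on `v` continued by zeros read the same bits up to `v.length`, so they
decide bit `m` at the same moment. -/
theorem Refutes.eq_false {q : Cantor} {v : List ℕ} {m : ℕ} (h : Refutes q v m) {c : ℕ → ℕ}
    (hc : ∀ i < v.length, c i = listSeq v i) {r : Cantor}
    (hr : Computes (tableOf q) (graphName c) r) : r m = false := by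
  obtain ⟨s, hs, h1, h2⟩ := h
  obtain ⟨t, ht1, ht2⟩ := hr m
  have e : ∀ k ≤ v.length, initSeg (graphName c) k = initSeg (graphName (listSeq v)) k :=
    fun k hk => initSeg_graphName_congr fun i hi => hc i (hi.trans_le hk)
  rcases lt_trichotomy s t with hlt | heq | hgt
  · have := ht2 s hlt
    rw [e s hs, h1] at this
    cases this
  · subst heq
    rw [e s hs, h1] at ht1
    exact (Option.some.inj ht1).symm
  · have := h2 t hgt
    rw [← e t (hgt.le.trans hs), ht1] at this
    cases this

/-- The time at which bit `m` is decided is finite, and any prefix of `c` of at least that length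
determines everything read so far. -/
theorem refutes_of_computes {q : Cantor} {c : ℕ → ℕ} {r : Cantor}
    (hr : Computes (tableOf q) (graphName c) r) {m : ℕ} (hm : r m = false) :
    ∃ s, ∀ v : List ℕ, s ≤ v.length → (∀ i < v.length, c i = listSeq v i) → Refutes q v m := by
  obtain ⟨s, h1, h2⟩ := hr m
  refine ⟨s, fun v hs hc => ⟨s, hs, ?_, fun t ht => ?_⟩⟩
  · rw [← hm, ← h1, initSeg_graphName_congr fun i hi => (hc i (hi.trans_le hs)).symm]
  · rw [← h2 t ht,
      initSeg_graphName_congr fun i hi => (hc i (hi.trans (ht.trans_le hs))).symm]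

/-! ### The Baire category argument -/

namespace ComputableMetricStructure

variable {X : Type u} [MetricSpace X] (M : ComputableMetricStructure X)

/-- The point `x` has a Cauchy name, with strict inequalities, that starts with the indices `v`. -/
def Near (v : List ℕ) (x : X) : Prop :=
  ∀ j < v.length, dist (M.point (listSeq v j)) x < 1 / 2 ^ j

/-- The complement of the closed set of those points `x` that are in the ball number `j` given by
`a`, with a margin of `2⁻ᵏ`, and for which no continuation of `a` to a name of `x` makes `q` write
`false` at a place `⟨n, i⟩` with `i₀ ≤ i`. -/
def pieceCompl (q : Cantor) (a : List ℕ) (n i₀ k : ℕ) (x : X) : Prop :=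
  (∃ j < a.length, (1 : ℝ) / 2 ^ j < dist (M.point (listSeq a j)) x + 1 / 2 ^ k) ∨
    ∃ v i, Refutes q (a ++ v) (Nat.pair n (i₀ + i)) ∧ M.Near (a ++ v) x

/-- Finitely many strict inequalities leave a common slack. This is what turns the open condition
`Near` into a countable union of closed ones. -/
theorem exists_margin {v : List ℕ} {x : X} (h : M.Near v x) :
    ∃ k : ℕ, ∀ j < v.length, dist (M.point (listSeq v j)) x + 1 / 2 ^ k ≤ 1 / 2 ^ j := by
  have lim : Tendsto (fun k : ℕ => (1 : ℝ) / 2 ^ k) atTop (𝓝 0) := by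
    simpa using tendsto_pow_atTop_nhds_zero_of_lt_one (r := (1 / 2 : ℝ)) (by norm_num)
      (by norm_num)
  have : ∀ᶠ k : ℕ in atTop, ∀ j ∈ Finset.range v.length,
      dist (M.point (listSeq v j)) x + 1 / 2 ^ k ≤ 1 / 2 ^ j := by
    rw [Filter.eventually_all_finset]
    intro j hj
    have hlt := sub_pos.2 (h j (Finset.mem_range.1 hj))
    filter_upwards [lim.eventually_lt_const hlt] with k hk
    linarith
  obtain ⟨k, hk⟩ := this.exists
  exact ⟨k, fun j hj => hk j (Finset.mem_range.2 hj)⟩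

theorem exists_point_lt (x : X) (j : ℕ) : ∃ k, dist (M.point k) x < 1 / 2 ^ j := by
  obtain ⟨k, hk⟩ := M.dense.exists_dist_lt x (by positivity : (0 : ℝ) < 1 / 2 ^ j)
  exact ⟨k, by rwa [dist_comm]⟩

/-- The conditions on the indices are independent of each other, and density satisfies each one
separately. -/
theorem Near.exists_extension {v : List ℕ} {x : X} (h : M.Near v x) :
    ∃ c : ℕ → ℕ, (∀ i < v.length, c i = listSeq v i) ∧ ∀ j, dist (M.point (c j)) x < 1 / 2 ^ j := by
  choose d hd using M.exists_point_lt x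
  refine ⟨fun i => if i < v.length then listSeq v i else d i, fun i hi => by simp [hi], fun j => ?_⟩
  by_cases hj : j < v.length
  · simpa [hj] using h j hj
  · simpa [hj] using hd j

theorem names_graphName {c : ℕ → ℕ} {x : X} (h : ∀ j, dist (M.point (c j)) x ≤ 1 / 2 ^ j) :
    M.space.Names (graphName c) x :=
  ⟨c, by simp [graphName], h⟩

/-- A limit name denotes `⊤` iff some column is eventually constant with value `true`. -/
theorem _root_.RepresentedSpace.iff_of_names_jump_sierpinski {r : Cantor} {P : Prop}
    (h : (jump sierpinski).Names r P) :
    P ↔ ∃ n i₀, ∀ i, r (Nat.pair n (i₀ + i)) = true := by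
  obtain ⟨s, hlim, hs⟩ := h
  have hev : ∀ n, ∃ i₀, ∀ i, r (Nat.pair n (i₀ + i)) = s n := by
    intro n
    have := (hlim n) (by simp : {s n} ∈ 𝓝 (s n))
    obtain ⟨i₀, hi⟩ := eventually_atTop.1 (show ∀ᶠ i in atTop, r (Nat.pair n i) = s n from this)
    exact ⟨i₀, fun i => hi _ (Nat.le_add_right _ _)⟩
  have hs' : P ↔ ∃ n, s n = true := hs
  rw [hs']
  refine exists_congr fun n => ⟨fun hn => ?_, fun ⟨i₀, hi⟩ => ?_⟩
  · obtain ⟨i₀, hi⟩ := hev n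
    exact ⟨i₀, fun i => (hi i).trans hn⟩
  · obtain ⟨i₁, hi₁⟩ := hev n
    rw [← hi₁ i₀, ← hi i₁, Nat.add_comm]

theorem Near.append_singleton {v : List ℕ} {x : X} (h : M.Near v x) :
    ∃ d, M.Near (v ++ [d]) x := by
  obtain ⟨d, hd⟩ := M.exists_point_lt x v.length
  refine ⟨d, fun j hj => ?_⟩
  rcases Nat.lt_succ_iff_lt_or_eq.1 (by simpa using hj : j < v.length + 1) with hlt | rfl
  · rw [listSeq_append_left hlt]
    exact h j hlt
  · simpa [listSeq] using hd

/-- If every initial segment of a name of `x` can be continued to refute each column arbitrarily far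
out, then some name of `x` has no column that is eventually `true`. -/
theorem exists_generic_name {q : Cantor} {x : X}
    (H : ∀ a, M.Near a x → ∀ n i₀, ∃ v i, Refutes q (a ++ v) (Nat.pair n (i₀ + i)) ∧
      M.Near (a ++ v) x) :
    ∃ c : ℕ → ℕ, (∀ j, dist (M.point (c j)) x < 1 / 2 ^ j) ∧
      ∀ n i₀, ∃ v i, (∀ j < v.length, c j = listSeq v j) ∧
        Refutes q v (Nat.pair n (i₀ + i)) := by
  -- Stage `m` meets the requirement `(n, i₀)` coded by `m`. One more index is appended because `v`
  -- may be empty and the prefixes have to grow.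
  have step : ∀ (m : ℕ) (a : {a // M.Near a x}), ∃ b : {a // M.Near a x},
      a.1.length < b.1.length ∧ a.1 <+: b.1 ∧
      ∃ v i, v <+: b.1 ∧ Refutes q v (Nat.pair (Nat.unpair m).1 ((Nat.unpair m).2 + i)) := by
    rintro m ⟨a, ha⟩
    obtain ⟨v, i, hv, hn⟩ := H a ha (Nat.unpair m).1 (Nat.unpair m).2
    obtain ⟨d, hd⟩ := hn.append_singleton
    refine ⟨⟨a ++ v ++ [d], hd⟩, ?_, ?_, a ++ v, i, List.prefix_append _ _, hv⟩
    · simp only [List.length_append, List.length_singleton]; omega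
    · simp
  choose g hg1 hg2 hg3 using step
  let L : ℕ → {a // M.Near a x} := fun m => Nat.rec ⟨[], fun j hj => by simp at hj⟩ g m
  have hlen : ∀ m, m ≤ (L m).1.length := by
    intro m
    induction m with
    | zero => exact Nat.zero_le _
    | succ m ih => exact Nat.succ_le_of_lt (ih.trans_lt (hg1 m (L m)))
  have hmono : ∀ m m', m ≤ m' → (L m).1 <+: (L m').1 := by
    intro m m' h
    induction h with
    | refl => exact List.prefix_refl _
    | step _ ih => exact ih.trans (hg2 _ _)
  have hseq : ∀ {v w : List ℕ}, v <+: w → ∀ j < v.length, listSeq v j = listSeq w j := by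
    rintro v _ ⟨w, rfl⟩ j hj
    exact (listSeq_append_left hj).symm
  have hc : ∀ m, ∀ j < (L m).1.length, listSeq (L (j + 1)).1 j = listSeq (L m).1 j := by
    intro m j hj
    rcases le_total m (j + 1) with h | h
    · exact (hseq (hmono _ _ h) j hj).symm
    · exact hseq (hmono _ _ h) j (hlen (j + 1))
  -- Stage `j + 1` has length at least `j + 1`, so its entry number `j` is genuine and not a default
  -- zero.
  refine ⟨fun j => listSeq (L (j + 1)).1 j, fun j => (L (j + 1)).2 j (hlen (j + 1)), fun n i₀ => ?_⟩
  obtain ⟨v, i, hv, hr⟩ := hg3 (Nat.pair n i₀) (L (Nat.pair n i₀))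
  rw [Nat.unpair_pair] at hr
  refine ⟨v, i, fun j hj => ?_, hr⟩
  rw [hseq hv j hj]
  exact hc (Nat.pair n i₀ + 1) j (hj.trans_le hv.length_le)

theorem iff_exists_not_pieceCompl {q : Cantor} {A : (jumpOpens M.space).carrier}
    (hq : (jumpOpens M.space).Names q A) (x : X) :
    A.1 x ↔ ∃ a n i₀ k, ¬ M.pieceCompl q a n i₀ k x := by
  have hname : ∀ c : ℕ → ℕ, (∀ j, dist (M.point (c j)) x < 1 / 2 ^ j) →
      ∃ r, Computes (tableOf q) (graphName c) r ∧
        (A.1 x ↔ ∃ n i₀, ∀ i, r (Nat.pair n (i₀ + i)) = true) := by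
    intro c hc
    obtain ⟨r, hr, hx⟩ := hq (graphName c) x (M.names_graphName fun j => (hc j).le)
    exact ⟨r, hr, iff_of_names_jump_sierpinski hx⟩
  constructor
  · intro hA
    by_contra! hcon
    have H : ∀ a, M.Near a x → ∀ n i₀, ∃ v i, Refutes q (a ++ v) (Nat.pair n (i₀ + i)) ∧
        M.Near (a ++ v) x := by
      intro a ha n i₀
      obtain ⟨k, hk⟩ := M.exists_margin ha
      rcases hcon a n i₀ k with ⟨j, hj, hlt⟩ | h
      · exact absurd (hk j hj) (not_le.2 hlt)
      · exact h
    obtain ⟨c, hc, hbad⟩ := M.exists_generic_name H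
    obtain ⟨r, hr, hiff⟩ := hname c hc
    obtain ⟨n, i₀, hall⟩ := hiff.1 hA
    obtain ⟨v, i, hv, href⟩ := hbad n i₀
    have := href.eq_false hv hr
    rw [hall i] at this
    cases this
  · rintro ⟨a, n, i₀, k, hnot⟩
    simp only [pieceCompl, not_or, not_exists, not_and, not_lt] at hnot
    obtain ⟨hball, hnot⟩ := hnot
    have hnear : M.Near a x := fun j hj => by
      have h1 := hball j hj
      have h2 : (0 : ℝ) < 1 / 2 ^ k := by positivity
      linarith
    obtain ⟨c, hca, hc⟩ := hnear.exists_extension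
    obtain ⟨r, hr, hiff⟩ := hname c hc
    refine hiff.2 ⟨n, i₀, fun i => ?_⟩
    by_contra hfalse
    obtain ⟨s, hs⟩ := refutes_of_computes hr (by simpa using hfalse)
    -- The next `s` indices of `c` after `a`: together with `a` they are long enough for the
    -- refutation found on `c`.
    let w : List ℕ := (List.range s).map fun j => c (a.length + j)
    have hlen : (a ++ w).length = a.length + s := by simp [w]
    have hw : ∀ j < (a ++ w).length, c j = listSeq (a ++ w) j := by
      intro j hj
      by_cases hja : j < a.length
      · rw [listSeq_append_left hja, hca j hja]
      · rw [hlen] at hj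
        have h1 : a.length ≤ j := not_lt.1 hja
        have h2 : j - a.length < s := by omega
        simp [listSeq, w, List.getElem?_append_right h1, h2, Nat.add_sub_cancel' h1]
    refine hnot w i (hs _ (by omega) hw) fun j hj => ?_
    rw [← hw j hj]
    exact hc j

end ComputableMetricStructure

/-! ### Closure properties of computable functions -/

/-- Bounded universal quantification over a Boolean predicate. -/
def allBelow (g : ℕ → Bool) (n : ℕ) : Bool := Nat.rec true (fun j b => b && g j) n

theorem allBelow_iff {g : ℕ → Bool} {n : ℕ} : allBelow g n = true ↔ ∀ j < n, g j = true := by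
  induction n with
  | zero => simp [allBelow]
  | succ n ih =>
    have : allBelow g (n + 1) = (allBelow g n && g n) := rfl
    rw [this, Bool.and_eq_true, ih, Nat.forall_lt_succ_right]

namespace Computable

variable {α β : Type*} [Primcodable α] [Primcodable β]

theorem band {f g : α → Bool} (hf : Computable f) (hg : Computable g) :
    Computable fun a => f a && g a :=
  (Primrec.and.to_comp.comp hf hg :)

theorem bor {f g : α → Bool} (hf : Computable f) (hg : Computable g) :
    Computable fun a => f a || g a :=
  (Primrec.or.to_comp.comp hf hg :)

theorem decide_lt {f g : α → ℕ} (hf : Computable f) (hg : Computable g) :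
    Computable fun a => decide (f a < g a) :=
  (Primrec.nat_lt.decide.to_comp.comp hf hg :)

theorem decide_le {f g : α → ℕ} (hf : Computable f) (hg : Computable g) :
    Computable fun a => decide (f a ≤ g a) :=
  (Primrec.nat_le.decide.to_comp.comp hf hg :)

theorem beq_const {f : α → Option Bool} (hf : Computable f) (b : Option Bool) :
    Computable fun a => f a == b :=
  (Primrec.eq.decide.to_comp.comp hf (const b)).of_eq fun a => by
    rw [Bool.eq_iff_iff]; simp

theorem add {f g : α → ℕ} (hf : Computable f) (hg : Computable g) :
    Computable fun a => f a + g a :=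
  (Primrec.nat_add.to_comp.comp hf hg :)

theorem mul {f g : α → ℕ} (hf : Computable f) (hg : Computable g) :
    Computable fun a => f a * g a :=
  (Primrec.nat_mul.to_comp.comp hf hg :)

theorem two_pow {f : α → ℕ} (hf : Computable f) : Computable fun a => 2 ^ f a := by
  have : Primrec fun n : ℕ => 2 ^ n :=
    (Primrec.nat_rec₁ 1 (Primrec.nat_mul.comp Primrec.snd (Primrec.const 2)).to₂).of_eq fun n => by
      induction n with
      | zero => rfl
      | succ n ih => simp only [pow_succ, ← ih]
  exact this.to_comp.comp hf

theorem natPair {f g : α → ℕ} (hf : Computable f) (hg : Computable g) :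
    Computable fun a => Nat.pair (f a) (g a) :=
  (Primrec₂.natPair.to_comp.comp hf hg :)

theorem allBelow {g : α → ℕ → Bool} {n : α → ℕ} (hg : Computable₂ g) (hn : Computable n) :
    Computable fun a => allBelow (g a) (n a) :=
  nat_rec hn (const true)
    ((band (snd.comp snd) (hg.comp fst (fst.comp snd))).to₂ :
      Computable₂ fun a (p : ℕ × Bool) => p.2 && g a p.1)

theorem decode_getD [Inhabited β] {f : α → ℕ} (hf : Computable f) :
    Computable fun a => ((Encodable.decode (f a) : Option β).getD default) :=
  option_getD (Computable.decode.comp hf) (const default)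

theorem listSeq {f : α → List ℕ} {g : α → ℕ} (hf : Computable f) (hg : Computable g) :
    Computable fun a => listSeq (f a) (g a) :=
  ((Primrec.list_getD 0).to_comp.comp hf hg :)

theorem getElem? {f : α → List β} {g : α → ℕ} (hf : Computable f) (hg : Computable g) :
    Computable fun a => (f a)[g a]? :=
  (list_getElem?.comp hf hg :)

theorem initSeg_graphName {f : α → List ℕ} {g : α → ℕ} (hf : Computable f) (hg : Computable g) :
    Computable fun a => initSeg (graphName (_root_.listSeq (f a))) (g a) := by
  have : Primrec₂ fun (v : List ℕ) (s : ℕ) => initSeg (graphName (_root_.listSeq v)) s := by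
    refine Primrec.list_map (Primrec.list_range.comp Primrec.snd) ?_
    have hu : Primrec fun x : (List ℕ × ℕ) × ℕ => Nat.unpair x.2 :=
      Primrec.unpair.comp Primrec.snd
    exact Primrec.eq.decide.comp ((Primrec.list_getD 0).comp (Primrec.fst.comp Primrec.fst)
      (Primrec.fst.comp hu)) (Primrec.snd.comp hu)
  exact this.to_comp.comp hf hg

end Computable

/-! ### Decidable tests and the machine tables -/

/-- The test for `Refutes q v m` with value of the reading time `s`, where only the finite part `z`
of `q` is used. -/
def checkRefutes (z : List Bool) (v : List ℕ) (m s : ℕ) : Bool :=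
  decide (s ≤ v.length) &&
  (z[Encodable.encode (initSeg (graphName (listSeq v)) s, m, false)]? == some true &&
  (z[Encodable.encode (initSeg (graphName (listSeq v)) s, m, true)]? == some false &&
  allBelow (fun t =>
    z[Encodable.encode (initSeg (graphName (listSeq v)) t, m, false)]? == some false) s))

/-- The test for `Near v`, with the point number `c` as an approximation to precision `2⁻ˡ`. -/
def checkNear (f : ℕ × ℕ × ℕ → ℕ) (v : List ℕ) (l c : ℕ) : Bool :=
  allBelow (fun j => decide ((f (listSeq v j, c, l) + 2) * 2 ^ j < 2 ^ l)) v.length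

/-- The test for being out of the closed ball number `j` of `a` with margin `2⁻ᵏ`, with the point
number `c` as an approximation to precision `2⁻ˡ`. -/
def checkFar (f : ℕ × ℕ × ℕ → ℕ) (a : List ℕ) (k j l c : ℕ) : Bool :=
  decide (j < a.length) && decide (2 ^ (k + l) + 2 * 2 ^ (j + k) <
    f (listSeq a j, c, l) * 2 ^ (j + k) + 2 ^ (l + j))

/-- The test whether the data `e` witness that the points with names that start with `w` are in the
complement of the piece with parameters `P`. -/
def checkPiece (f : ℕ × ℕ × ℕ → ℕ) (z w : List Bool) (P : List ℕ × ℕ × ℕ × ℕ)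
    (e : ℕ × ℕ × List ℕ × ℕ × ℕ × ℕ) : Bool :=
  w[Nat.pair e.1 e.2.1]? == some true &&
  (checkFar f P.1 P.2.2.2 e.2.2.2.2.2 e.1 e.2.1 ||
  (checkRefutes z (P.1 ++ e.2.2.1) (Nat.pair P.2.1 (P.2.2.1 + e.2.2.2.1)) e.2.2.2.2.1 &&
    checkNear f (P.1 ++ e.2.2.1) e.1 e.2.1))

/-- The test of the witness whose code is the first component of the length of `w`. -/
def checkIndex (f : ℕ × ℕ × ℕ → ℕ) (z w : List Bool) (N : ℕ) : Bool :=
  checkPiece f z w ((Encodable.decode N : Option (List ℕ × ℕ × ℕ × ℕ)).getD default)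
    ((Encodable.decode (Nat.unpair w.length).1 :
      Option (ℕ × ℕ × List ℕ × ℕ × ℕ × ℕ)).getD default)

/-- Bit number `j` of the name of the open set number `N`. -/
def openBit (f : ℕ × ℕ × ℕ → ℕ) (z : List Bool) (N j : ℕ) : Bool :=
  let t := (Encodable.decode j : Option (List Bool × ℕ × Bool)).getD default
  cond t.2.2 (checkIndex f z t.1 N) (decide (t.2.1 ≤ t.1.length))

/-- Bit number `m` of the name of the sequence of open sets. -/
def sequenceBit (f : ℕ × ℕ × ℕ → ℕ) (z : List Bool) (m : ℕ) : Bool :=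
  let t := (Encodable.decode m : Option (List Bool × ℕ × Bool)).getD default
  cond t.2.2 (openBit f z (t.1.length - 1) t.2.1) (t.1[t.1.length - 1]? == some true)

/-- The table of the machine for the multivalued inverse. -/
def inverseTable (f : ℕ × ℕ × ℕ → ℕ) (z : List Bool) (m : ℕ) : Option Bool :=
  cond (decide (m ≤ z.length)) (some (sequenceBit f z m)) none

section

open Computable

variable {α : Type*} [Primcodable α] {f : ℕ × ℕ × ℕ → ℕ}

theorem computable_checkRefutes {z : α → List Bool} {v : α → List ℕ} {m s : α → ℕ}
    (hz : Computable z) (hv : Computable v) (hm : Computable m) (hs : Computable s) :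
    Computable fun a => checkRefutes (z a) (v a) (m a) (s a) := by
  have bit : ∀ (o : Option Bool) (b : Bool), Computable₂ fun (a : α) (t : ℕ) =>
      (z a)[Encodable.encode (initSeg (graphName (listSeq (v a))) t, m a, b)]? == o := fun o b =>
    beq_const (getElem? (hz.comp fst) (Computable.encode.comp
      ((initSeg_graphName (hv.comp fst) snd).pair ((hm.comp fst).pair (const b))))) o
  exact band (decide_le hs (list_length.comp hv)) (band ((bit _ _).comp .id hs)
    (band ((bit _ _).comp .id hs) (.allBelow (bit _ _) hs)))

theorem computable_checkNear (hf : Computable f) {v : α → List ℕ} {l c : α → ℕ}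
    (hv : Computable v) (hl : Computable l) (hc : Computable c) :
    Computable fun a => checkNear f (v a) (l a) (c a) := by
  have : Computable₂ fun (a : α) (j : ℕ) =>
      decide ((f (listSeq (v a) j, c a, l a) + 2) * 2 ^ j < 2 ^ l a) :=
    decide_lt (mul (add (hf.comp ((Computable.listSeq (hv.comp fst) snd).pair
      ((hc.comp fst).pair (hl.comp fst)))) (const 2)) (two_pow snd)) (two_pow (hl.comp fst))
  exact .allBelow this (list_length.comp hv)

theorem computable_checkFar (hf : Computable f) {v : α → List ℕ} {k j l c : α → ℕ}
    (hv : Computable v) (hk : Computable k) (hj : Computable j) (hl : Computable l)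
    (hc : Computable c) :
    Computable fun a => checkFar f (v a) (k a) (j a) (l a) (c a) :=
  band (decide_lt hj (list_length.comp hv)) (decide_lt
    (add (two_pow (add hk hl)) (mul (const 2) (two_pow (add hj hk))))
    (add (mul (hf.comp ((Computable.listSeq hv hj).pair (hc.pair hl))) (two_pow (add hj hk)))
      (two_pow (add hl hj))))

theorem computable_checkPiece (hf : Computable f) {z w : α → List Bool}
    {P : α → List ℕ × ℕ × ℕ × ℕ} {e : α → ℕ × ℕ × List ℕ × ℕ × ℕ × ℕ}
    (hz : Computable z) (hw : Computable w) (hP : Computable P) (he : Computable e) :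
    Computable fun a => checkPiece f (z a) (w a) (P a) (e a) := by
  have e2 := snd.comp he
  have e3 := snd.comp e2
  have e4 := snd.comp e3
  have e5 := snd.comp e4
  have P2 := snd.comp hP
  have P3 := snd.comp P2
  have hv := list_append.comp (fst.comp hP) (fst.comp e3)
  exact band (beq_const (getElem? hw (natPair (fst.comp he) (fst.comp e2))) _)
    (bor (computable_checkFar hf (fst.comp hP) (snd.comp P3) (snd.comp e5) (fst.comp he)
        (fst.comp e2))
      (band (computable_checkRefutes hz hv
          (natPair (fst.comp P2) (add (fst.comp P3) (fst.comp e4))) (fst.comp e5))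
        (computable_checkNear hf hv (fst.comp he) (fst.comp e2))))

theorem computable_checkIndex (hf : Computable f) {z w : α → List Bool} {N : α → ℕ}
    (hz : Computable z) (hw : Computable w) (hN : Computable N) :
    Computable fun a => checkIndex f (z a) (w a) (N a) :=
  computable_checkPiece hf hz hw (decode_getD hN)
    (decode_getD (fst.comp (Computable.unpair.comp (list_length.comp hw))))

theorem computable_openBit (hf : Computable f) {z : α → List Bool} {N j : α → ℕ}
    (hz : Computable z) (hN : Computable N) (hj : Computable j) :
    Computable fun a => openBit f (z a) (N a) (j a) := by
  have ht : Computable fun a =>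
      (Encodable.decode (j a) : Option (List Bool × ℕ × Bool)).getD default := decode_getD hj
  exact Computable.cond (snd.comp (snd.comp ht)) (computable_checkIndex hf hz (fst.comp ht) hN)
    (decide_le (fst.comp (snd.comp ht)) (list_length.comp (fst.comp ht)))

theorem computable_sequenceBit (hf : Computable f) {z : α → List Bool} {m : α → ℕ}
    (hz : Computable z) (hm : Computable m) :
    Computable fun a => sequenceBit f (z a) (m a) := by
  have key : ∀ t : α → List Bool × ℕ × Bool, Computable t → Computable fun a =>
      cond (t a).2.2 (openBit f (z a) ((t a).1.length - 1) (t a).2.1)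
        ((t a).1[(t a).1.length - 1]? == some true) := by
    intro t ht
    have hlast : Computable fun a => (t a).1.length - 1 :=
      Computable.pred.comp (list_length.comp (fst.comp ht))
    exact Computable.cond (snd.comp (snd.comp ht))
      (computable_openBit hf hz hlast (fst.comp (snd.comp ht)))
      (beq_const (getElem? (fst.comp ht) hlast) _)
  exact key _ (decode_getD hm)

theorem computable_inverseTable (hf : Computable f) : Computable₂ (inverseTable f) :=
  Computable.cond (decide_le snd (list_length.comp fst))
    (option_some.comp (computable_sequenceBit hf fst snd)) (const none)

end

/-! ### Soundness and completeness of the tests -/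

theorem getElem?_beq_iff {z : List Bool} {i : ℕ} {b : Bool} :
    (z[i]? == some b) = true ↔ z[i]? = some b := by simp

theorem refutes_of_checkRefutes {q : Cantor} {K : ℕ} {v : List ℕ} {m s : ℕ}
    (h : checkRefutes (initSeg q K) v m s = true) : Refutes q v m := by
  simp only [checkRefutes, Bool.and_eq_true, decide_eq_true_eq, allBelow_iff,
    getElem?_beq_iff] at h
  obtain ⟨h1, h2, h3, h4⟩ := h
  exact ⟨s, h1, tableOf_eq_some.2 ⟨eq_of_getElem?_initSeg h2, eq_of_getElem?_initSeg h3⟩,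
    fun t ht => tableOf_eq_none.2 (eq_of_getElem?_initSeg (h4 t ht))⟩

/-- A refutation consults finitely many bits of `q`, so every sufficiently long part of `q` confirms
it. -/
theorem Refutes.exists_check {q : Cantor} {v : List ℕ} {m : ℕ} (h : Refutes q v m) :
    ∃ s, ∀ᶠ K in atTop, checkRefutes (initSeg q K) v m s = true := by
  obtain ⟨s, h1, h2, h3⟩ := h
  obtain ⟨h2, h2'⟩ := tableOf_eq_some.1 h2
  refine ⟨s, ?_⟩
  have hall : ∀ᶠ K in atTop, ∀ t ∈ Finset.range s,
      Encodable.encode (initSeg (graphName (listSeq v)) t, m, false) < K := by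
    rw [Filter.eventually_all_finset]
    exact fun t _ => eventually_gt_atTop _
  filter_upwards [eventually_gt_atTop
      (Encodable.encode (initSeg (graphName (listSeq v)) s, m, false)),
    eventually_gt_atTop (Encodable.encode (initSeg (graphName (listSeq v)) s, m, true)),
    hall] with K hK1 hK2 hK3
  simp only [checkRefutes, Bool.and_eq_true, decide_eq_true_eq, allBelow_iff,
    getElem?_beq_iff]
  refine ⟨h1, ?_, ?_, fun t ht => ?_⟩
  · rw [getElem?_initSeg_of_lt q hK1, h2]
  · rw [getElem?_initSeg_of_lt q hK2, h2']
  · rw [getElem?_initSeg_of_lt q (hK3 t (Finset.mem_range.2 ht)), tableOf_eq_none.1 (h3 t ht)]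

/-- Clearing denominators leaves an inequality between natural numbers, which is decidable. The
summand `2 / 2 ^ l` is the error bound of `ApproximatesDist.abs_sub_le`. -/
theorem near_inequality_iff (d j l : ℕ) :
    (d + 2) * 2 ^ j < 2 ^ l ↔ (d : ℝ) / 2 ^ l + 2 / 2 ^ l < 1 / 2 ^ j := by
  rw [← add_div, div_lt_div_iff₀ (by positivity) (by positivity), one_mul]
  exact_mod_cast Iff.rfl

theorem far_inequality_iff (d j k l : ℕ) :
    2 ^ (k + l) + 2 * 2 ^ (j + k) < d * 2 ^ (j + k) + 2 ^ (l + j) ↔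
      (1 : ℝ) / 2 ^ j + 2 / 2 ^ l < (d : ℝ) / 2 ^ l + 1 / 2 ^ k := by
  have e1 : (1 : ℝ) / 2 ^ j + 2 / 2 ^ l =
      ((2 ^ (k + l) + 2 * 2 ^ (j + k) : ℕ) : ℝ) / (2 ^ j * 2 ^ k * 2 ^ l) := by
    push_cast
    field_simp
    ring
  have e2 : (d : ℝ) / 2 ^ l + 1 / 2 ^ k =
      ((d * 2 ^ (j + k) + 2 ^ (l + j) : ℕ) : ℝ) / (2 ^ j * 2 ^ k * 2 ^ l) := by
    push_cast
    field_simp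
    ring
  rw [e1, e2, div_lt_div_iff_of_pos_right (by positivity), Nat.cast_lt]

namespace ComputableMetricStructure

variable {X : Type u} [MetricSpace X] (M : ComputableMetricStructure X)

/-- `f (i, j, k) / 2ᵏ` approximates the distance of the points number `i` and `j` up to `2⁻ᵏ`. -/
def ApproximatesDist (f : ℕ × ℕ × ℕ → ℕ) : Prop :=
  ∀ i j k, |dist (M.point i) (M.point j) - (f (i, j, k) : ℝ) / 2 ^ k| ≤ 1 / 2 ^ k

variable {M} {f : ℕ × ℕ × ℕ → ℕ}

/-- One error `2⁻ˡ` comes from replacing `x` by the point number `c`, another one from the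
approximation to the distance. -/
theorem ApproximatesDist.abs_sub_le (hf : M.ApproximatesDist f) {x : X} {c l : ℕ}
    (hc : dist (M.point c) x ≤ 1 / 2 ^ l) (i : ℕ) :
    |dist (M.point i) x - (f (i, c, l) : ℝ) / 2 ^ l| ≤ 2 / 2 ^ l := by
  have h1 := abs_le.1 (hf i c l)
  have h2 := dist_triangle (M.point i) (M.point c) x
  have h3 := dist_triangle_right (M.point i) (M.point c) x
  have h4 : (2 : ℝ) / 2 ^ l = 1 / 2 ^ l + 1 / 2 ^ l := by ring
  rw [abs_le]
  constructor <;> linarith [h1.1, h1.2]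

theorem ApproximatesDist.near_of_checkNear (hf : M.ApproximatesDist f) {x : X} {c l : ℕ}
    (hc : dist (M.point c) x ≤ 1 / 2 ^ l) {v : List ℕ} (h : checkNear f v l c = true) :
    M.Near v x := by
  simp only [checkNear, allBelow_iff, decide_eq_true_eq, near_inequality_iff] at h
  intro j hj
  have := abs_le.1 (hf.abs_sub_le hc (listSeq v j))
  linarith [h j hj, this.2]

theorem ApproximatesDist.of_checkFar (hf : M.ApproximatesDist f) {x : X} {c l : ℕ}
    (hc : dist (M.point c) x ≤ 1 / 2 ^ l) {a : List ℕ} {k j : ℕ}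
    (h : checkFar f a k j l c = true) :
    j < a.length ∧ (1 : ℝ) / 2 ^ j < dist (M.point (listSeq a j)) x + 1 / 2 ^ k := by
  simp only [checkFar, Bool.and_eq_true, decide_eq_true_eq, far_inequality_iff] at h
  have := abs_le.1 (hf.abs_sub_le hc (listSeq a j))
  exact ⟨h.1, by linarith [h.2, this.1]⟩

/-- The constant is `2 + 2`: the safety margin built into the tests plus the actual error of the
approximation. -/
theorem eventually_four_div_lt {ε : ℝ} (hε : 0 < ε) : ∀ᶠ l : ℕ in atTop, (4 : ℝ) / 2 ^ l < ε := by
  have lim : Tendsto (fun l : ℕ => (4 : ℝ) / 2 ^ l) atTop (𝓝 0) := by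
    have := (tendsto_pow_atTop_nhds_zero_of_lt_one (r := (1 / 2 : ℝ)) (by norm_num)
      (by norm_num)).const_mul 4
    simpa [div_eq_mul_inv] using this
  exact lim.eventually_lt_const hε

theorem ApproximatesDist.exists_checkNear (hf : M.ApproximatesDist f) {x : X} {c : ℕ → ℕ}
    (hc : ∀ l, dist (M.point (c l)) x ≤ 1 / 2 ^ l) {v : List ℕ} (h : M.Near v x) :
    ∃ l, checkNear f v l (c l) = true := by
  have : ∀ᶠ l : ℕ in atTop, ∀ j ∈ Finset.range v.length,
      (4 : ℝ) / 2 ^ l < 1 / 2 ^ j - dist (M.point (listSeq v j)) x := by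
    rw [Filter.eventually_all_finset]
    exact fun j hj => eventually_four_div_lt (sub_pos.2 (h j (Finset.mem_range.1 hj)))
  obtain ⟨l, hl⟩ := this.exists
  refine ⟨l, ?_⟩
  simp only [checkNear, allBelow_iff, decide_eq_true_eq, near_inequality_iff]
  intro j hj
  have h1 := abs_le.1 (hf.abs_sub_le (hc l) (listSeq v j))
  have h2 := hl j (Finset.mem_range.2 hj)
  have h3 : (4 : ℝ) / 2 ^ l = 2 / 2 ^ l + 2 / 2 ^ l := by ring
  linarith [h1.1]

theorem ApproximatesDist.exists_checkFar (hf : M.ApproximatesDist f) {x : X} {c : ℕ → ℕ}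
    (hc : ∀ l, dist (M.point (c l)) x ≤ 1 / 2 ^ l) {a : List ℕ} {k j : ℕ} (hj : j < a.length)
    (h : (1 : ℝ) / 2 ^ j < dist (M.point (listSeq a j)) x + 1 / 2 ^ k) :
    ∃ l, checkFar f a k j l (c l) = true := by
  obtain ⟨l, hl⟩ := (eventually_four_div_lt (sub_pos.2 h)).exists
  refine ⟨l, ?_⟩
  simp only [checkFar, Bool.and_eq_true, decide_eq_true_eq, far_inequality_iff]
  have h1 := abs_le.1 (hf.abs_sub_le (hc l) (listSeq a j))
  have h3 : (4 : ℝ) / 2 ^ l = 2 / 2 ^ l + 2 / 2 ^ l := by ring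
  exact ⟨hj, by linarith [h1.2]⟩

/-! ### Names of the open sets and of their sequence -/

variable (M)

/-- The open set number `N`, where `N` codes the parameters of a piece. -/
def codedOpen (q : Cantor) (N : ℕ) (x : X) : Prop :=
  let P := (Encodable.decode N : Option (List ℕ × ℕ × ℕ × ℕ)).getD default
  M.pieceCompl q P.1 P.2.1 P.2.2.1 P.2.2.2 x

variable {M}

/-- A passed test yields a true witness whatever the lengths `K` and `m` are. Default values of
failed decodings do no harm, since they are tested like any other data. -/
theorem ApproximatesDist.codedOpen_of_checkIndex (hf : M.ApproximatesDist f) {q p : Cantor} {x : X}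
    (hp : M.space.Names p x) {K m N : ℕ}
    (h : checkIndex f (initSeg q K) (initSeg p m) N = true) : M.codedOpen q N x := by
  obtain ⟨c, hpc, hc⟩ := hp
  unfold checkIndex at h
  unfold codedOpen
  revert h
  generalize ((Encodable.decode N : Option (List ℕ × ℕ × ℕ × ℕ)).getD default) = P
  generalize ((Encodable.decode (Nat.unpair (initSeg p m).length).1 :
      Option (ℕ × ℕ × List ℕ × ℕ × ℕ × ℕ)).getD default) = e
  obtain ⟨a, n, i₀, k⟩ := P
  obtain ⟨l, C, v, i, s, j⟩ := e
  intro h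
  simp only [checkPiece, Bool.and_eq_true, Bool.or_eq_true, getElem?_beq_iff] at h
  obtain ⟨hC, h⟩ := h
  have hC : c l = C := by
    have := eq_of_getElem?_initSeg hC
    rw [hpc] at this
    exact of_decide_eq_true this
  have hdist : dist (M.point C) x ≤ 1 / 2 ^ l := hC ▸ hc l
  rcases h with h | ⟨h1, h2⟩
  · exact Or.inl ⟨j, hf.of_checkFar hdist h⟩
  · exact Or.inr ⟨v, i, refutes_of_checkRefutes h1, hf.near_of_checkNear hdist h2⟩

theorem ApproximatesDist.exists_checkIndex (hf : M.ApproximatesDist f) {q p : Cantor} {x : X}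
    (hp : M.space.Names p x) {N : ℕ} (h : M.codedOpen q N x) :
    ∃ m, ∀ K ≥ m, checkIndex f (initSeg q K) (initSeg p m) N = true := by
  obtain ⟨c, hpc, hc⟩ := hp
  unfold codedOpen at h
  unfold checkIndex
  revert h
  generalize ((Encodable.decode N : Option (List ℕ × ℕ × ℕ × ℕ)).getD default) = P
  obtain ⟨a, n, i₀, k⟩ := P
  intro h
  obtain ⟨l, v, i, s, j, hev⟩ : ∃ l v i s j, ∀ᶠ K in atTop, (checkFar f a k j l (c l) ||
      (checkRefutes (initSeg q K) (a ++ v) (Nat.pair n (i₀ + i)) s &&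
        checkNear f (a ++ v) l (c l))) = true := by
    rcases h with ⟨j, hj, h⟩ | ⟨v, i, h1, h2⟩
    · obtain ⟨l, hl⟩ := hf.exists_checkFar hc hj h
      exact ⟨l, [], 0, 0, j, Eventually.of_forall fun K => by simp [hl]⟩
    · obtain ⟨l, hl⟩ := hf.exists_checkNear hc h2
      obtain ⟨s, hs⟩ := h1.exists_check
      refine ⟨l, v, i, s, 0, hs.mono fun K hK => ?_⟩
      simp only [hK, hl, Bool.and_self, Bool.or_true]
  obtain ⟨K₀, hK₀⟩ := eventually_atTop.1 hev
  let e : ℕ × ℕ × List ℕ × ℕ × ℕ × ℕ := (l, c l, v, i, s, j)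
  -- The second component of the length is padding: it makes the prefix of `p` reach the bit that
  -- confirms `c l`, and makes every `K` above the length exceed `K₀`.
  let t := K₀ + (Nat.pair l (c l) + 1)
  have ht : t ≤ Nat.pair (Encodable.encode e) t := Nat.right_le_pair _ _
  refine ⟨Nat.pair (Encodable.encode e) t, fun K hK => ?_⟩
  have hdec : ((Encodable.decode (Nat.unpair (initSeg p (Nat.pair (Encodable.encode e) t)).length).1 :
      Option (ℕ × ℕ × List ℕ × ℕ × ℕ × ℕ)).getD default) = e := by
    rw [length_initSeg, Nat.unpair_pair, Encodable.encodek, Option.getD_some]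
  rw [hdec, checkPiece, Bool.and_eq_true, getElem?_beq_iff]
  refine ⟨?_, hK₀ K (by omega)⟩
  rw [getElem?_initSeg_of_lt p (show Nat.pair l (c l) < _ by omega), hpc]
  simp

/-- Output bit `m` is stored in a table at a code that is at least `m`, so later output bits are
computed from longer parts of `q`. -/
theorem le_encode_snd (w : List Bool) (m : ℕ) (b : Bool) :
    m ≤ Encodable.encode (w, m, b) :=
  (Nat.left_le_pair _ _).trans (Nat.right_le_pair _ _)

/-- The bits `openBit` of an open set form a name of it, if the part of `q` that is used for bit
number `j` has length at least `j`. -/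
theorem ApproximatesDist.exists_computes_codedOpen (hf : M.ApproximatesDist f) (q : Cantor) (N : ℕ)
    {K : ℕ → ℕ} (hK : ∀ j, j ≤ K j) {p : Cantor} {x : X} (hp : M.space.Names p x) :
    ∃ r, Computes (tableOf fun j => openBit f (initSeg q (K j)) N j) p r ∧
      sierpinski.Names r (M.codedOpen q N x) := by
  -- Output bit `m` is decided after exactly `m` input bits and tests one candidate witness. Since
  -- `m` runs over all lengths, every witness is tried with every padding.
  refine ⟨fun m => checkIndex f (initSeg q (K (Encodable.encode (initSeg p m, m, true))))
    (initSeg p m) N, fun m => ⟨m, tableOf_eq_some.2 ⟨?_, ?_⟩, fun t ht => tableOf_eq_none.2 ?_⟩,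
    fun h => ?_, fun ⟨m, hm⟩ => hf.codedOpen_of_checkIndex hp hm⟩
  · rw [openBit, Encodable.encodek]
    simp
  · rw [openBit, Encodable.encodek]
    simp only [Option.getD_some, cond_true]
  · rw [openBit, Encodable.encodek]
    simpa using ht
  · obtain ⟨m, hm⟩ := hf.exists_checkIndex hp h
    exact ⟨m, hm _ ((le_encode_snd _ m _).trans (hK _))⟩

theorem ApproximatesDist.isContinuousMap_codedOpen (hf : M.ApproximatesDist f) (q : Cantor)
    (N : ℕ) : IsContinuousMap (X := M.space) (Y := sierpinski) (M.codedOpen q N) :=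
  isContinuousMap_of_table _ fun _ _ hp =>
    hf.exists_computes_codedOpen q N (K := fun j => j) (fun _ => le_rfl) hp

/-- The sequence of the sets `codedOpen q N` as a map to the space of open sets. -/
def openSequence (hf : M.ApproximatesDist f) (q : Cantor) (N : ℕ) : (opens M.space).carrier :=
  ⟨M.codedOpen q N, hf.isContinuousMap_codedOpen q N⟩

theorem exists_computes_openSequence (hf : M.ApproximatesDist f) (q p : Cantor) (N : ℕ)
    (hp : nat.Names p N) :
    ∃ r, Computes (tableOf fun m => sequenceBit f (initSeg q m) m) p r ∧
      (opens M.space).Names r (openSequence hf q N) := by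
  have hp : p = fun k => decide (k = N) := hp
  -- The only `true` in the name of `N` is bit number `N`, so the table answers after `N + 1` bits
  -- and recovers `N` from that length.
  refine ⟨fun j => openBit f (initSeg q (Encodable.encode (initSeg p (N + 1), j, true))) N j,
    fun j => ⟨N + 1, tableOf_eq_some.2 ⟨?_, ?_⟩, fun t ht => tableOf_eq_none.2 ?_⟩,
    fun p' x hx => hf.exists_computes_codedOpen q N (fun j => le_encode_snd _ j _) hx⟩
  · rw [sequenceBit, Encodable.encodek]
    simp only [Option.getD_some, cond_false, length_initSeg, Nat.add_sub_cancel]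
    simp only [getElem?_initSeg_of_lt _ (Nat.lt_succ_self N), hp, decide_true, BEq.rfl]
  · rw [sequenceBit, Encodable.encodek]
    simp
  · rw [sequenceBit, Encodable.encodek]
    simp only [Option.getD_some, cond_false, length_initSeg]
    -- For `t = 0` the truncated `t - 1` may equal `N`, but the empty prefix has no last bit.
    have : t - 1 ≠ N ∨ t = 0 := by omega
    rw [getElem?_initSeg]
    rcases this with h | rfl
    · split_ifs <;> simp [hp, h]
    · simp

theorem computes_inverseTable (q : Cantor) :
    Computes (inverseTable f) q fun m => sequenceBit f (initSeg q m) m := by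
  refine fun m => ⟨m, by simp [inverseTable], fun t ht => ?_⟩
  have : ¬ m ≤ t := not_le.2 ht
  simp only [inverseTable, length_initSeg, this, decide_false, cond_false]

end ComputableMetricStructure

theorem proposition25 {X : Type u} [MetricSpace X] (M : ComputableMetricStructure X) :
    RepresentedSpace.HasComputableMultivaluedInverse
      (X := RepresentedSpace.contMaps RepresentedSpace.nat (RepresentedSpace.opens M.space))
      (Y := RepresentedSpace.jumpOpens M.space)
      (RepresentedSpace.unionCompl M.space) := by
  obtain ⟨f, hfc, hdist⟩ := M.dist_computable
  have hf : M.ApproximatesDist f := hdist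
  refine ⟨inverseTable f, computable_inverseTable hfc, fun q A hq =>
    ⟨_, ComputableMetricStructure.computes_inverseTable q,
      ⟨ComputableMetricStructure.openSequence hf q, isContinuousMap_of_table _
        (ComputableMetricStructure.exists_computes_openSequence hf q)⟩, ?_,
      ComputableMetricStructure.exists_computes_openSequence hf q⟩⟩
  refine Subtype.ext (funext fun x => propext ?_)
  change (∃ N, ¬ M.codedOpen q N x) ↔ A.1 x
  refine Iff.trans ?_ (M.iff_exists_not_pieceCompl hq x).symm
  constructor
  · rintro ⟨N, hN⟩
    -- Every `N` yields the parameters of some piece, the default ones if decoding fails.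
    exact ⟨_, _, _, _, hN⟩
  · rintro ⟨a, n, i₀, k, h⟩
    refine ⟨Encodable.encode (a, n, i₀, k), ?_⟩
    simpa only [ComputableMetricStructure.codedOpen, Encodable.encodek, Option.getD_some] using h
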